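/- Let $d$ be a nonnegative integer and let $|\cdot|$ be the Euclidean norm on $\mathbb{R}^d$. A stochastic process $\{X_t\}_{t\ge 0}$ on $\mathbb{R}^d$ is an additive process if $X_0=0$ a.s., it is stochastically continuous, it has independent increments, and almost surely its sample paths are right-continuous in $t\ge 0$ and have left limits in $t>0$. A Lévy process is an additive process with stationary increments. For $p>0$, a semi-Lévy process with period $p$ is an additive process such that $X_{t+p}-X_{s+p}$ and $X_t-X_s$ have the same law for all $s,t\ge 0$. An additive process $\{X_t\}_{t\ge0}$ is recurrent if for every $s\ge 0$ one has $\liminf_{t\to\infty}|X_t-X_s|=0$ almost surely. Theorem 1.2. Let $p>0$, let $\{X_t\}_{t\ge 0}$ be a semi-Lévy process on $\mathbb{R}^d$ with period $p$, and let $\{Y_t\}_{t\ge 0}$ be a Lévy process on $\mathbb{R}^d$ (possibly defined on another probability space) such that $Y_1$ and $X_p$ have the same law. Then $\{X_t\}_{t\ge 0}$ is recurrent if and only if $\{Y_t\}_{t\ge 0}$ is recurrent. -/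

import Mathlib

open MeasureTheory ProbabilityTheory Filter Topology
open scoped NNReal ENNReal

/-- `X` is an additive process on `ℝ^d` (over the probability measure `P`): it starts at `0` a.s.,
has independent increments, is stochastically continuous, and almost surely its sample paths are
right-continuous at every `t ≥ 0` and have left limits at every `t > 0`. -/
structure IsAdditiveProcess {d : ℕ} {Ω : Type*} [MeasurableSpace Ω]
    (X : ℝ≥0 → Ω → EuclideanSpace ℝ (Fin d)) (P : Measure Ω) : Prop where
  measurable : ∀ t, Measurable (X t)
  start_zero : ∀ᵐ ω ∂P, X 0 ω = 0
  stochastically_continuous : ∀ t, TendstoInMeasure P X (𝓝 t) (X t)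
  indep_increments : HasIndepIncrements X P
  cadlag : ∀ᵐ ω ∂P,
    (∀ t, ContinuousWithinAt (fun s => X s ω) (Set.Ici t) t) ∧
    (∀ t, 0 < t → ∃ l, Tendsto (fun s => X s ω) (𝓝[<] t) (𝓝 l))

/-- A Lévy process: an additive process with stationary increments, i.e. the law of
`X (s + h) - X s` does not depend on `s`. -/
structure IsLevyProcess {d : ℕ} {Ω : Type*} [MeasurableSpace Ω]
    (X : ℝ≥0 → Ω → EuclideanSpace ℝ (Fin d)) (P : Measure Ω) : Prop
    extends IsAdditiveProcess X P where
  stationary : ∀ s s' h,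
    IdentDistrib (fun ω => X (s + h) ω - X s ω) (fun ω => X (s' + h) ω - X s' ω) P P

/-- A semi-Lévy process with period `p > 0`: an additive process whose increments over the time
interval shifted by `p` have the same law. -/
structure IsSemiLevyProcess {d : ℕ} {Ω : Type*} [MeasurableSpace Ω]
    (X : ℝ≥0 → Ω → EuclideanSpace ℝ (Fin d)) (P : Measure Ω) (p : ℝ≥0) : Prop
    extends IsAdditiveProcess X P where
  period_pos : 0 < p
  periodic : ∀ s t,
    IdentDistrib (fun ω => X (t + p) ω - X (s + p) ω) (fun ω => X t ω - X s ω) P P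

/-- `s`-recurrence: `liminf_{t → ∞} |X_t - X_s| = 0` almost surely. The liminf is taken
in `[0, ∞]`, so that it is `∞` when `|X_t - X_s| → ∞`. -/
def IsRecurrentFrom {d : ℕ} {Ω : Type*} [MeasurableSpace Ω]
    (X : ℝ≥0 → Ω → EuclideanSpace ℝ (Fin d)) (P : Measure Ω) (s : ℝ≥0) : Prop :=
  ∀ᵐ ω ∂P, liminf (fun t => ‖X t ω - X s ω‖ₑ) atTop = 0

/-- A process is recurrent if it is `s`-recurrent for every `s ≥ 0`. -/
def IsRecurrentProcess {d : ℕ} {Ω : Type*} [MeasurableSpace Ω]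
    (X : ℝ≥0 → Ω → EuclideanSpace ℝ (Fin d)) (P : Measure Ω) : Prop :=
  ∀ s, IsRecurrentFrom X P s

/-! Sampled once per period from any starting time, a semi-Lévy process is a random walk whose
i.i.d. steps have the law of `X p`; a Lévy process is the case of period 1. Hence X and Y carry
walks with the same law, and it is enough that recurrence be equivalent to a property of the walk
alone: infinitely many expected visits to some ball.

If the expectation is infinite, some arbitrarily small ball also has infinite expectation, and a
last-visit argument brings the walk back near the origin infinitely often
(`ae_frequently_norm_sum_lt`). This holds for every starting time, so the process is recurrent.

Conversely, 0-recurrence makes the path enter the unit ball in infinitely many periods. Increments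
within a period are uniformly tight, so Ottaviani's inequality bounds the probability of entering
during a period by twice that of the walk being in a larger ball at its end. Were these summable,
Borel–Cantelli would forbid the returns (`IsSemiLevyProcess.exists_tsum_eq_top`). Right-continuity
lets dyadic times stand for all times. -/

section RandomWalk

/-! ### Random walks: Ottaviani's inequality and recurrence from infinite expected visits -/

/-- Events of the past and of the future of an independent sequence are independent. -/
theorem iIndepFun.measure_inter_past_future {E Ω : Type*} [MeasurableSpace E]
    [MeasurableSpace Ω] {P : Measure Ω} {ξ : ℕ → Ω → E} (hξ : ∀ i, Measurable (ξ i))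
    (hind : iIndepFun ξ P)
    (m : ℕ) {A B : Set Ω}
    (hA : MeasurableSet[⨆ i ∈ Set.Iio m, MeasurableSpace.comap (ξ i) inferInstance] A)
    (hB : MeasurableSet[⨆ i ∈ Set.Ici m, MeasurableSpace.comap (ξ i) inferInstance] B) :
    P (A ∩ B) = P A * P B := by
  have h := indep_iSup_of_disjoint (fun i => (hξ i).comap_le) hind.iIndep
    (S := Set.Iio m) (T := Set.Ici m) (by
      rw [Set.disjoint_left]; intro x hx hx'; exact not_lt.2 (Set.mem_Ici.1 hx') (Set.mem_Iio.1 hx))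
  exact (Indep_iff _ _ _).1 h A B hA hB

theorem measurable_sum_comap {E Ω : Type*} [NormedAddCommGroup E] [MeasurableSpace E]
    [BorelSpace E] [SecondCountableTopology E] {ξ : ℕ → Ω → E} (s : Finset ℕ)
    (T : Set ℕ) (h : ∀ i ∈ s, i ∈ T) :
    Measurable[⨆ i ∈ T, MeasurableSpace.comap (ξ i) inferInstance]
      (fun ω => ∑ i ∈ s, ξ i ω) := by
  refine Finset.measurable_fun_sum s fun i hi => ?_
  refine Measurable.mono (comap_measurable (ξ i)) ?_ le_rfl
  exact le_iSup₂_of_le i (h i hi) le_rfl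

variable {E : Type*} [NormedAddCommGroup E] [MeasurableSpace E] [BorelSpace E]
  [SecondCountableTopology E] {Ω : Type*} [mΩ : MeasurableSpace Ω] {P : Measure Ω}
  {ξ : ℕ → Ω → E}

/-- Ottaviani's inequality for entering a ball: if from each time of `s` the walk stays within
distance `b` until time `N` with probability at least `1/2`, then the probability that it visits
the ball of radius `a` during `s` is controlled by that of being in a larger ball at time `N`. -/
theorem iIndepFun.measure_exists_norm_sum_lt_le (hξ : ∀ i, Measurable (ξ i))
    (hind : iIndepFun ξ P) (N : ℕ) (s : Finset ℕ) (hs : ∀ j ∈ s, j ≤ N) (a b : ℝ)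
    (hb : ∀ j ∈ s, 2⁻¹ ≤ P {ω | ‖∑ i ∈ Finset.range N, ξ i ω - ∑ i ∈ Finset.range j, ξ i ω‖ ≤ b}) :
    P {ω | ∃ j ∈ s, ‖∑ i ∈ Finset.range j, ξ i ω‖ < a} ≤
      2 * P {ω | ‖∑ i ∈ Finset.range N, ξ i ω‖ < a + b} := by
  set S : ℕ → Ω → E := fun n ω => ∑ i ∈ Finset.range n, ξ i ω with hS
  have hSm : ∀ n, Measurable (S n) := fun n => Finset.measurable_fun_sum _ fun i _ => hξ i
  -- First-entrance decomposition: `A j` depends only on steps before `j`, `D j` only on later ones.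
  set A : ℕ → Set Ω := fun j => {ω | ‖S j ω‖ < a} ∩ ⋂ i ∈ s.filter (· < j), {ω | a ≤ ‖S i ω‖}
    with hA
  set D : ℕ → Set Ω := fun j => {ω | ‖S N ω - S j ω‖ ≤ b} with hD
  have hAm : ∀ j, MeasurableSet (A j) := fun j =>
    (measurableSet_lt (hSm j).norm measurable_const).inter
      (Finset.measurableSet_biInter _ fun i _ => measurableSet_le measurable_const (hSm i).norm)
  have hDm : ∀ j, MeasurableSet (D j) := fun j =>
    measurableSet_le ((hSm N).sub (hSm j)).norm measurable_const
  have hprod : ∀ j ∈ s, P (A j ∩ D j) = P (A j) * P (D j) := by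
    intro j hj
    refine iIndepFun.measure_inter_past_future hξ hind j ?_ ?_
    · have key : ∀ i ≤ j, Measurable[⨆ i ∈ Set.Iio j, MeasurableSpace.comap (ξ i) inferInstance]
          (fun ω => ‖S i ω‖) := fun i hi =>
        measurable_norm.comp (measurable_sum_comap (Finset.range i) (Set.Iio j) fun k hk =>
          lt_of_lt_of_le (Finset.mem_range.1 hk) hi)
      refine MeasurableSet.inter (key j le_rfl measurableSet_Iio) ?_
      exact Finset.measurableSet_biInter _ fun i hi =>
        key i (Finset.mem_filter.1 hi).2.le measurableSet_Ici
    · have : D j = {ω | ‖∑ i ∈ Finset.Ico j N, ξ i ω‖ ≤ b} := by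
        ext ω
        simp only [hD, hS, Set.mem_ofPred_eq, ← Finset.sum_Ico_eq_sub (fun i => ξ i ω) (hs j hj)]
      rw [this]
      exact measurable_norm.comp (measurable_sum_comap (Finset.Ico j N) (Set.Ici j) fun k hk =>
          (Finset.mem_Ico.1 hk).1) measurableSet_Iic
  have hdisj : ∀ i ∈ s, ∀ j ∈ s, i < j → Disjoint (A i) (A j) := by
    intro i hi j hj hij
    rw [Set.disjoint_left]
    rintro ω ⟨h1, -⟩ ⟨-, h2⟩
    have h3 : a ≤ ‖S i ω‖ := Set.mem_iInter₂.1 h2 i (Finset.mem_filter.2 ⟨hi, hij⟩)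
    exact not_lt.2 h3 h1
  have hpd : Set.PairwiseDisjoint (s : Set ℕ) (fun j => A j ∩ D j) := by
    intro i hi j hj hij
    refine Disjoint.mono Set.inter_subset_left Set.inter_subset_left ?_
    rcases lt_or_gt_of_ne hij with h | h
    · exact hdisj i hi j hj h
    · exact (hdisj j hj i hi h).symm
  calc P {ω | ∃ j ∈ s, ‖S j ω‖ < a} ≤ P (⋃ j ∈ s, A j) := by
        refine measure_mono ?_
        rintro ω ⟨j, hj, hja⟩
        classical
        have hex : ∃ j, j ∈ s ∧ ‖S j ω‖ < a := ⟨j, hj, hja⟩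
        refine Set.mem_iUnion₂.2 ⟨Nat.find hex, (Nat.find_spec hex).1, (Nat.find_spec hex).2, ?_⟩
        refine Set.mem_iInter₂.2 fun i hi => ?_
        have hi' := Finset.mem_filter.1 hi
        have := Nat.find_min hex hi'.2
        simp only [not_and, not_lt] at this
        exact this hi'.1
    _ ≤ ∑ j ∈ s, P (A j) := measure_biUnion_finset_le _ _
    _ ≤ ∑ j ∈ s, 2 * P (A j ∩ D j) := by
        refine Finset.sum_le_sum fun j hj => ?_
        rw [hprod j hj]
        calc P (A j) = 2 * (P (A j) * 2⁻¹) := by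
              rw [mul_comm (P (A j)), ← mul_assoc, ENNReal.mul_inv_cancel (by simp) (by simp),
                one_mul]
          _ ≤ 2 * (P (A j) * P (D j)) := by gcongr; exact hb j hj
    _ = 2 * P (⋃ j ∈ s, A j ∩ D j) := by
        rw [← Finset.mul_sum, measure_biUnion_finset hpd fun j _ => (hAm j).inter (hDm j)]
    _ ≤ 2 * P {ω | ‖S N ω‖ < a + b} := by
        gcongr
        refine Set.iUnion₂_subset fun j _ ω hω => ?_
        have h1 : ‖S j ω‖ < a := hω.1.1
        have h2 : ‖S N ω - S j ω‖ ≤ b := hω.2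
        have := norm_le_norm_add_norm_sub (S j ω) (S N ω)
        have h3 := norm_sub_rev (S j ω) (S N ω)
        show ‖S N ω‖ < a + b
        linarith

/-- Families of events such that the times of occurrence all lie within `k` of one another
have summable probabilities. -/
theorem tsum_measure_le_of_forall_lt_add [IsProbabilityMeasure P] {A : ℕ → Set Ω}
    (hA : ∀ m, MeasurableSet (A m)) (k : ℕ)
    (h : ∀ ω m n, m ≤ n → ω ∈ A m → ω ∈ A n → n < m + k) : ∑' m, P (A m) ≤ k := by
  calc ∑' m, P (A m) = ∑' m, ∫⁻ ω, (A m).indicator 1 ω ∂P := by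
        simp_rw [lintegral_indicator_one (hA _)]
    _ = ∫⁻ ω, ∑' m, (A m).indicator 1 ω ∂P :=
        (lintegral_tsum fun m => (measurable_one.indicator (hA m)).aemeasurable).symm
    _ ≤ ∫⁻ _, (k : ℝ≥0∞) ∂P := by
        refine lintegral_mono fun ω => ?_
        by_cases hex : ∃ m, ω ∈ A m
        · classical
          have hmin := Nat.find_spec hex
          rw [tsum_eq_sum (s := Finset.Ico (Nat.find hex) (Nat.find hex + k))]
          · calc _ ≤ ∑ m ∈ Finset.Ico (Nat.find hex) (Nat.find hex + k), (1 : ℝ≥0∞) :=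
                  Finset.sum_le_sum fun m _ => Set.indicator_le_self' (by simp) ω
              _ = k := by simp
          · intro m hm
            refine Set.indicator_of_notMem (fun hmA => hm ?_) _
            have hle := Nat.find_min' hex hmA
            exact Finset.mem_Ico.2 ⟨hle, h ω _ _ hle hmin hmA⟩
        · push Not at hex
          simp [Set.indicator_of_notMem (hex _)]
    _ = k := by simp

/-- If the expected number of visits of a random walk to a set of diameter less than `δ` is
infinite, then the walk returns to the `δ`-ball about the origin at arbitrarily late times. -/
theorem measure_forall_le_norm_sum_eq_zero [IsProbabilityMeasure P] (hξ : ∀ i, Measurable (ξ i))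
    (hind : iIndepFun ξ P) (hid : ∀ i, IdentDistrib (ξ i) (ξ 0) P P) {B : Set E}
    (hB : MeasurableSet B) {δ : ℝ} (hδ : ∀ x ∈ B, ∀ y ∈ B, ‖x - y‖ < δ)
    (hsum : ∑' m, P {ω | ∑ i ∈ Finset.range m, ξ i ω ∈ B} = ∞) (k : ℕ) :
    P {ω | ∀ n, k ≤ n → δ ≤ ‖∑ i ∈ Finset.range n, ξ i ω‖} = 0 := by
  set ρ := P {ω | ∀ n, k ≤ n → δ ≤ ‖∑ i ∈ Finset.range n, ξ i ω‖} with hρ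
  have hSm : ∀ n, Measurable (fun ω => ∑ i ∈ Finset.range n, ξ i ω) :=
    fun n => Finset.measurable_fun_sum _ fun i _ => hξ i
  set V : ℕ → Set Ω := fun m => {ω | ∑ i ∈ Finset.range m, ξ i ω ∈ B} with hV
  -- `F m` is the escape event for the walk restarted at time `m`: independent of `V m`, and of
  -- probability `ρ` for every `m`.
  set F : ℕ → Set Ω := fun m =>
    {ω | ∀ n, k ≤ n → δ ≤ ‖∑ i ∈ Finset.range n, ξ (m + i) ω‖} with hF
  have hFm : ∀ m, MeasurableSet (F m) := by
    intro m
    simp only [hF, Set.ofPred_forall]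
    exact MeasurableSet.iInter fun n => MeasurableSet.iInter fun _ =>
      measurableSet_le measurable_const (Finset.measurable_fun_sum _ fun i _ => hξ _).norm
  have hFρ : ∀ m, P (F m) = ρ := by
    intro m
    have hlaw : IdentDistrib (fun ω (i : ℕ) => ξ (m + i) ω) (fun ω (i : ℕ) => ξ i ω) P P :=
      IdentDistrib.pi (fun i => (hid _).trans (hid i).symm)
        (hind.precomp (add_right_injective m)) hind
    refine hlaw.measure_mem_eq (s := {x | ∀ n, k ≤ n → δ ≤ ‖∑ i ∈ Finset.range n, x i‖}) ?_
    simp only [Set.ofPred_forall]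
    exact MeasurableSet.iInter fun n => MeasurableSet.iInter fun _ =>
      measurableSet_le measurable_const
        (Finset.measurable_fun_sum _ fun i _ => measurable_pi_apply i).norm
  have hprod : ∀ m, P (V m ∩ F m) = P (V m) * ρ := by
    intro m
    rw [← hFρ m]
    refine iIndepFun.measure_inter_past_future hξ hind m ?_ ?_
    · exact (measurable_sum_comap (Finset.range m) (Set.Iio m) fun k hk =>
        Finset.mem_range.1 hk) hB
    · simp only [hF, Set.ofPred_forall]
      refine MeasurableSet.iInter fun n => MeasurableSet.iInter fun _ => ?_
      have h1 : ∀ ω, ∑ i ∈ Finset.range n, ξ (m + i) ω = ∑ i ∈ Finset.Ico m (m + n), ξ i ω := by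
        intro ω
        rw [Finset.sum_Ico_eq_sum_range, Nat.add_sub_cancel_left]
      simp only [h1]
      exact measurable_norm.comp (measurable_sum_comap (Finset.Ico m (m + n)) (Set.Ici m)
        fun k hk => (Finset.mem_Ico.1 hk).1) measurableSet_Ici
  -- Two visits to `B` differ by less than `δ`, so after a visit followed by escape no visit occurs
  -- `k` or more steps later.
  have hle : ∑' m, P (V m ∩ F m) ≤ ((k + 1 : ℕ) : ℝ≥0∞) := by
    refine tsum_measure_le_of_forall_lt_add (fun m => ((hSm m) hB).inter (hFm m)) _ ?_
    rintro ω m n hmn ⟨hm, hmF⟩ ⟨hn, -⟩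
    by_contra! hlt
    have h1 := hmF (n - m) (by omega)
    have h2 : ∑ i ∈ Finset.range (n - m), ξ (m + i) ω =
        ∑ i ∈ Finset.range n, ξ i ω - ∑ i ∈ Finset.range m, ξ i ω := by
      rw [← Finset.sum_Ico_eq_sub (fun i => ξ i ω) hmn, Finset.sum_Ico_eq_sum_range]
    rw [h2] at h1
    exact absurd (hδ _ hn _ hm) (not_lt.2 h1)
  -- The sum factors as `∞ * ρ` and is finite, so `ρ = 0`.
  simp_rw [hprod] at hle
  rw [ENNReal.tsum_mul_right, hsum] at hle
  by_contra hne
  rw [ENNReal.top_mul hne] at hle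
  exact absurd hle (by simp)

/-- A random walk whose expected number of visits to some ball is infinite comes back
arbitrarily close to the origin infinitely often. -/
theorem ae_frequently_norm_sum_lt [ProperSpace E] [IsProbabilityMeasure P]
    (hξ : ∀ i, Measurable (ξ i))
    (hind : iIndepFun ξ P) (hid : ∀ i, IdentDistrib (ξ i) (ξ 0) P P) {c : ℝ}
    (hsum : ∑' m, P {ω | ‖∑ i ∈ Finset.range m, ξ i ω‖ < c} = ∞) {ε : ℝ} (hε : 0 < ε) :
    ∀ᵐ ω ∂P, ∃ᶠ n in atTop, ‖∑ i ∈ Finset.range n, ξ i ω‖ < ε := by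
  -- Pigeonhole over a finite cover; radius `ε / 2` makes the pieces have differences below `ε`.
  obtain ⟨t, ht, hcov⟩ := Metric.totallyBounded_iff.1
    ((isCompact_closedBall (0 : E) c).totallyBounded) (ε / 2) (half_pos hε)
  obtain ⟨y, -, hy⟩ : ∃ y ∈ ht.toFinset,
      ∑' m, P {ω | ∑ i ∈ Finset.range m, ξ i ω ∈ Metric.ball y (ε / 2)} = ∞ := by
    by_contra! hfin
    have hlt : ∑ y ∈ ht.toFinset,
        ∑' m, P {ω | ∑ i ∈ Finset.range m, ξ i ω ∈ Metric.ball y (ε / 2)} < ∞ :=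
      ENNReal.sum_lt_top.2 fun y hy => lt_top_iff_ne_top.2 (hfin y hy)
    rw [← Summable.tsum_finsetSum fun _ _ => ENNReal.summable] at hlt
    refine absurd (hsum ▸ lt_of_le_of_lt (ENNReal.tsum_le_tsum fun m => ?_) hlt) (lt_irrefl _)
    refine (measure_mono ?_).trans (measure_biUnion_finset_le ht.toFinset _)
    intro ω hω
    have hmem : ∑ i ∈ Finset.range m, ξ i ω ∈ Metric.closedBall (0 : E) c := by
      rw [mem_closedBall_zero_iff]; exact le_of_lt hω
    obtain ⟨y, hyt, hyb⟩ := Set.mem_iUnion₂.1 (hcov hmem)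
    exact Set.mem_iUnion₂.2 ⟨y, ht.mem_toFinset.2 hyt, hyb⟩
  have h0 := measure_forall_le_norm_sum_eq_zero hξ hind hid measurableSet_ball (δ := ε)
    (fun x hx z hz => by
      rw [← dist_eq_norm]
      have := dist_triangle_right x z y
      rw [Metric.mem_ball] at hx hz
      linarith) hy
  have hall : ∀ᵐ ω ∂P, ∀ k, ¬ ∀ n, k ≤ n → ε ≤ ‖∑ i ∈ Finset.range n, ξ i ω‖ :=
    ae_all_iff.2 fun k => by
      rw [ae_iff]
      simpa only [not_not] using h0 k
  filter_upwards [hall] with ω hω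
  refine frequently_atTop.2 fun k => ?_
  have := hω k
  push Not at this
  obtain ⟨n, hn, h⟩ := this
  exact ⟨n, hn, h⟩

/-- The partial sums of two independent sequences with the same marginals have the same law. -/
theorem iIndepFun.identDistrib_sum_range {Ω' : Type*} [MeasurableSpace Ω'] {P' : Measure Ω'}
    {η : ℕ → Ω' → E} (hξ : iIndepFun ξ P) (hη : iIndepFun η P')
    (hid : ∀ i, IdentDistrib (ξ i) (η i) P P') (n : ℕ) :
    IdentDistrib (fun ω => ∑ i ∈ Finset.range n, ξ i ω) (fun ω => ∑ i ∈ Finset.range n, η i ω)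
      P P' :=
  (IdentDistrib.pi hid hξ hη).comp
    (u := fun x : ℕ → E => ∑ i ∈ Finset.range n, x i)
    (Finset.measurable_fun_sum _ fun i _ => measurable_pi_apply i)

end RandomWalk

/-! ### The walk embedded in a semi-Lévy process, and tightness over a period -/

section SemiLevy

variable {d : ℕ} {Ω : Type*} [MeasurableSpace Ω] {P : Measure Ω}
  {X : ℝ≥0 → Ω → EuclideanSpace ℝ (Fin d)} {p : ℝ≥0}

/-- Makes the two directions of the main theorem instances of one transfer statement. -/
theorem IsLevyProcess.isSemiLevyProcess_one (h : IsLevyProcess X P) :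
    IsSemiLevyProcess X P 1 where
  __ := h
  period_pos := one_pos
  periodic s t := by
    have key : ∀ s t : ℝ≥0, s ≤ t → IdentDistrib (fun ω => X (t + 1) ω - X (s + 1) ω)
        (fun ω => X t ω - X s ω) P P := by
      intro s t hst
      have := h.stationary (s + 1) s (t - s)
      rwa [add_right_comm, add_tsub_cancel_of_le hst] at this
    rcases le_total s t with hst | hts
    · exact key s t hst
    · have := (key t s hts).comp measurable_neg
      simpa only [Function.comp_def, neg_sub] using this

theorem sum_range_sub_add_nat_mul {E : Type*} [AddCommGroup E] (f : ℝ≥0 → E) (p s : ℝ≥0) (n : ℕ) :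
    ∑ i ∈ Finset.range n, (f (s + (i + 1 : ℕ) * p) - f (s + i * p)) = f (s + n * p) - f s := by
  rw [Finset.sum_range_sub (fun i : ℕ => f (s + i * p))]
  simp

namespace IsSemiLevyProcess

theorem identDistrib_sub_add_nat_mul (h : IsSemiLevyProcess X P p) (s t : ℝ≥0) (n : ℕ) :
    IdentDistrib (fun ω => X (t + n * p) ω - X (s + n * p) ω) (fun ω => X t ω - X s ω) P P := by
  induction n with
  | zero =>
    simp only [Nat.cast_zero, zero_mul, add_zero]
    exact IdentDistrib.refl ((h.measurable t).sub (h.measurable s)).aemeasurable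
  | succ n ih =>
    have := (h.periodic (s + n * p) (t + n * p)).trans ih
    simp only [Nat.cast_succ, add_mul, one_mul, ← add_assoc]
    exact this

/-- An increment over a full period has the law of the process at the period, wherever the
period starts. -/
theorem identDistrib_add_period_sub [IsProbabilityMeasure P] (h : IsSemiLevyProcess X P p)
    (s : ℝ≥0) : IdentDistrib (fun ω => X (s + p) ω - X s ω) (X p) P P := by
  -- Split the increment at `p`. The part after `p` has the law of `X s - X 0`, and independence of
  -- the two parts allows this replacement; the sum becomes `X p - X 0`.
  have key : ∀ s ≤ p, IdentDistrib (fun ω => X (s + p) ω - X s ω) (X p) P P := by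
    intro s hs
    have hind1 := h.indep_increments.indepFun_sub_sub zero_le hs
    have hind2 := (h.indep_increments.indepFun_sub_sub hs (le_add_self : p ≤ s + p)).symm
    have hper := h.periodic 0 s
    rw [zero_add] at hper
    have hpair := IdentDistrib.prodMk hper
      (IdentDistrib.refl ((h.measurable p).sub (h.measurable s)).aemeasurable) hind2 hind1
    have hsum := hpair.comp (u := fun x => x.1 + x.2) (by fun_prop)
    have h1 : (fun ω => X (s + p) ω - X s ω) =
        (fun x : EuclideanSpace ℝ (Fin d) × EuclideanSpace ℝ (Fin d) => x.1 + x.2) ∘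
        (fun ω => (X (s + p) ω - X p ω, (X p - X s) ω)) := by
      ext1 ω; simp
    rw [h1]
    refine hsum.trans (IdentDistrib.of_ae_eq ?_ ?_)
    · have := h.measurable s; have := h.measurable 0; have := h.measurable p
      exact Measurable.aemeasurable (by simp only [Function.comp_def, Pi.sub_apply]; fun_prop)
    · filter_upwards [h.start_zero] with ω hω
      simp [hω]
  have hp : 0 < p := h.period_pos
  obtain ⟨n, r, hr, rfl⟩ : ∃ (n : ℕ) (r : ℝ≥0), r ≤ p ∧ s = r + n * p := by
    refine ⟨⌊s / p⌋₊, s - ⌊s / p⌋₊ * p, ?_, ?_⟩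
    · rw [tsub_le_iff_left]
      have := (Nat.lt_floor_add_one (s / p)).le
      rw [div_le_iff₀ hp] at this
      linarith
    · rw [tsub_add_cancel_of_le]
      have := Nat.floor_le (zero_le : 0 ≤ s / p)
      rwa [le_div_iff₀ hp] at this
  have := (h.identDistrib_sub_add_nat_mul r (r + p) n).trans (key r hr)
  rwa [add_right_comm] at this

theorem monotone_add_nat_mul (s p : ℝ≥0) : Monotone fun n : ℕ => s + n * p :=
  fun m n hmn => by
    have : (m : ℝ≥0) ≤ n := by exact_mod_cast hmn
    dsimp only
    gcongr

theorem identDistrib_step [IsProbabilityMeasure P] (h : IsSemiLevyProcess X P p) (s : ℝ≥0)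
    (i : ℕ) : IdentDistrib (fun ω => X (s + (i + 1 : ℕ) * p) ω - X (s + i * p) ω) (X p) P P := by
  have := h.identDistrib_add_period_sub (s + i * p)
  convert this using 4
  push_cast; ring_nf

theorem iIndepFun_step (h : IsSemiLevyProcess X P p) (s : ℝ≥0) :
    iIndepFun (fun (i : ℕ) ω => X (s + (i + 1 : ℕ) * p) ω - X (s + i * p) ω) P :=
  h.indep_increments.nat (monotone_add_nat_mul s p)

/-- If the walk `X (n * p)` has infinitely many expected visits to some ball, then the process
with the same law over one period is recurrent. -/
theorem isRecurrentProcess_of_tsum_eq_top {Ω' : Type*} [MeasurableSpace Ω'] {P' : Measure Ω'}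
    [IsProbabilityMeasure P] [IsProbabilityMeasure P']
    {Y : ℝ≥0 → Ω' → EuclideanSpace ℝ (Fin d)} {q : ℝ≥0}
    (hX : IsSemiLevyProcess X P p) (hY : IsSemiLevyProcess Y P' q)
    (hXY : IdentDistrib (X p) (Y q) P P') {c : ℝ}
    (hsum : ∑' n : ℕ, P {ω | ‖X (n * p) ω - X 0 ω‖ < c} = ∞) : IsRecurrentProcess Y P' := by
  intro s
  have hlaw := iIndepFun.identDistrib_sum_range (hX.iIndepFun_step 0) (hY.iIndepFun_step s)
    fun i => (hX.identDistrib_step 0 i).trans (hXY.trans (hY.identDistrib_step s i).symm)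
  have hsum' : ∑' n : ℕ, P' {ω | ‖∑ i ∈ Finset.range n,
      (Y (s + (i + 1 : ℕ) * q) ω - Y (s + i * q) ω)‖ < c} = ∞ := by
    rw [← hsum]
    refine tsum_congr fun n => ?_
    have := (hlaw n).measure_mem_eq (s := {x | ‖x‖ < c})
      (measurableSet_lt measurable_norm measurable_const)
    rw [show {ω | ‖X (n * p) ω - X 0 ω‖ < c} = {ω | ‖∑ i ∈ Finset.range n,
      (X (0 + (i + 1 : ℕ) * p) ω - X (0 + i * p) ω)‖ < c} by
        ext ω; rw [Set.mem_ofPred_eq, Set.mem_ofPred_eq,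
          sum_range_sub_add_nat_mul (fun t => X t ω), zero_add]]
    exact this.symm
  have hmeas : ∀ i : ℕ, Measurable fun ω => Y (s + (i + 1 : ℕ) * q) ω - Y (s + i * q) ω :=
    fun i => (hY.measurable _).sub (hY.measurable _)
  have hfreq : ∀ᵐ ω ∂P', ∀ k : ℕ, ∃ᶠ n in atTop, ‖∑ i ∈ Finset.range n,
      (Y (s + (i + 1 : ℕ) * q) ω - Y (s + i * q) ω)‖ < 1 / ((k : ℝ) + 1) :=
    ae_all_iff.2 fun k => ae_frequently_norm_sum_lt hmeas (hY.iIndepFun_step s)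
      (fun i => (hY.identDistrib_step s i).trans (hY.identDistrib_step s 0).symm) hsum'
      (by positivity)
  filter_upwards [hfreq] with ω hω
  have htend : Tendsto (fun n : ℕ => s + n * q) atTop atTop :=
    tendsto_atTop_mono (fun n => le_add_self)
      (tendsto_natCast_atTop_atTop.atTop_mul_const hY.period_pos)
  refine le_antisymm (le_of_forall_gt fun ε hε => ?_) zero_le
  obtain ⟨δ, hδ0, hδ⟩ : ∃ δ : ℝ≥0, 0 < δ ∧ (δ : ℝ≥0∞) < ε := by
    obtain ⟨δ, h0, h1⟩ := ENNReal.lt_iff_exists_nnreal_btwn.1 hε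
    exact ⟨δ, by exact_mod_cast h0, h1⟩
  obtain ⟨k, hk⟩ := exists_nat_one_div_lt (show (0 : ℝ) < δ by exact_mod_cast hδ0)
  refine lt_of_le_of_lt (liminf_le_of_frequently_le' ?_) hδ
  refine htend.frequently ((hω k).mono fun n hn => ?_)
  rw [sum_range_sub_add_nat_mul (fun t => Y t ω)] at hn
  rw [← ofReal_norm, ENNReal.ofReal_le_coe]
  exact (hn.trans hk).le

end IsSemiLevyProcess

/-- A stochastically continuous process is uniformly tight, relative to any fixed time, over
a compact set of times. -/
theorem exists_forall_half_le_measure_norm_sub_le [IsProbabilityMeasure P]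
    (hm : ∀ t, Measurable (X t)) (hX : ∀ t, TendstoInMeasure P X (𝓝 t) (X t)) {K : Set ℝ≥0}
    (hK : IsCompact K) (u : ℝ≥0) :
    ∃ b : ℝ, ∀ r ∈ K, 2⁻¹ ≤ P {ω | ‖X u ω - X r ω‖ ≤ b} := by
  refine hK.induction_on (p := fun s => ∃ b : ℝ, ∀ r ∈ s, 2⁻¹ ≤ P {ω | ‖X u ω - X r ω‖ ≤ b})
    ⟨0, by simp⟩ ?_ ?_ ?_
  · rintro s t hst ⟨b, hb⟩
    exact ⟨b, fun r hr => hb r (hst hr)⟩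
  · rintro s t ⟨b, hb⟩ ⟨b', hb'⟩
    refine ⟨max b b', fun r hr => ?_⟩
    rcases hr with hr | hr
    · exact (hb r hr).trans (measure_mono fun ω (hω : _ ≤ b) =>
        (le_trans hω (le_max_left _ _) : _ ≤ max b b'))
    · exact (hb' r hr).trans (measure_mono fun ω (hω : _ ≤ b') =>
        (le_trans hω (le_max_right _ _) : _ ≤ max b b'))
  · intro r _
    have h1 : Tendsto (fun n : ℕ => P {ω | (n : ℝ) < ‖X u ω - X r ω‖}) atTop (𝓝 0) := by
      have hemp : ⋂ n : ℕ, {ω | (n : ℝ) < ‖X u ω - X r ω‖} = ∅ := by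
        refine Set.eq_empty_iff_forall_notMem.2 fun ω hω => ?_
        obtain ⟨n, hn⟩ := exists_nat_ge ‖X u ω - X r ω‖
        have h2 : (n : ℝ) < ‖X u ω - X r ω‖ := Set.mem_iInter.1 hω n
        exact not_lt.2 hn h2
      have := tendsto_measure_iInter_atTop (μ := P)
        (s := fun n : ℕ => {ω | (n : ℝ) < ‖X u ω - X r ω‖})
        (fun n => (measurableSet_lt measurable_const
          ((hm u).sub (hm r)).norm).nullMeasurableSet)
        (fun m n hmn ω (hω : (n : ℝ) < _) => lt_of_le_of_lt (Nat.cast_le.2 hmn) hω)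
        ⟨0, measure_ne_top _ _⟩
      rwa [hemp, measure_empty] at this
    -- Two exceptional events of probability below 1/4 each: `X r` far from `X u`, and `X t` at
    -- distance at least 1 from `X r`.
    have h4 : (0 : ℝ≥0∞) < 4⁻¹ := by simp
    obtain ⟨n, hn⟩ := (h1.eventually_lt_const h4).exists
    have h2 := (tendstoInMeasure_iff_norm.1 (hX r) 1 one_pos).eventually_lt_const h4
    refine ⟨_, mem_nhdsWithin_of_mem_nhds h2, n + 1, fun t ht => ?_⟩
    have ht' : P {ω | 1 ≤ ‖X t ω - X r ω‖} < 4⁻¹ := ht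
    have hcompl : P {ω | ‖X u ω - X t ω‖ ≤ n + 1}ᶜ ≤ 2⁻¹ := by
      calc P {ω | ‖X u ω - X t ω‖ ≤ n + 1}ᶜ
          ≤ P ({ω | (n : ℝ) < ‖X u ω - X r ω‖} ∪ {ω | 1 ≤ ‖X t ω - X r ω‖}) := by
            refine measure_mono fun ω hω => ?_
            have hω' : (n : ℝ) + 1 < ‖X u ω - X t ω‖ := not_le.1 hω
            by_contra hcon
            have h5 : ¬ (n : ℝ) < ‖X u ω - X r ω‖ := fun h => hcon (Or.inl h)
            have h6 : ¬ 1 ≤ ‖X t ω - X r ω‖ := fun h => hcon (Or.inr h)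
            have := norm_sub_le_norm_sub_add_norm_sub (X u ω) (X r ω) (X t ω)
            rw [norm_sub_rev (X r ω)] at this
            linarith
        _ ≤ 4⁻¹ + 4⁻¹ := (measure_union_le _ _).trans (add_le_add hn.le ht'.le)
        _ = 2⁻¹ := by
            rw [← ENNReal.toReal_eq_toReal_iff' (by simp) (by simp)]
            rw [ENNReal.toReal_add (by simp) (by simp)]
            norm_num
    have hmeas : MeasurableSet {ω | ‖X u ω - X t ω‖ ≤ n + 1} :=
      measurableSet_le ((hm u).sub (hm t)).norm measurable_const
    rw [prob_compl_eq_one_sub hmeas] at hcompl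
    rw [tsub_le_iff_right] at hcompl
    have h7 : (2⁻¹ : ℝ≥0∞) + 2⁻¹ ≤ 2⁻¹ + P {ω | ‖X u ω - X t ω‖ ≤ n + 1} := by
      rwa [ENNReal.inv_two_add_inv_two]
    exact (ENNReal.add_le_add_iff_left (by simp)).1 h7

end SemiLevy

/-! ### From returns of the path to visits of the walk -/

section Hitting

variable {d : ℕ} {Ω : Type*} [MeasurableSpace Ω] {P : Measure Ω}
  {X : ℝ≥0 → Ω → EuclideanSpace ℝ (Fin d)} {p : ℝ≥0}

/-- The times `0, n p, (n + 1/M) p, …, (n + 1) p, (n + 1) p, …`. -/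
noncomputable def periodGrid (p : ℝ≥0) (n M : ℕ) : ℕ → ℝ≥0
  | 0 => 0
  | j + 1 => (n + ((min j M : ℕ) : ℝ≥0) / M) * p

theorem periodGrid_monotone (p : ℝ≥0) (n M : ℕ) : Monotone (periodGrid p n M) := by
  refine monotone_nat_of_le_succ fun j => ?_
  cases j with
  | zero => exact zero_le
  | succ j =>
    have : ((min j M : ℕ) : ℝ≥0) ≤ (min (j + 1) M : ℕ) := by
      exact_mod_cast min_le_min_right M (Nat.le_succ j)
    simp only [periodGrid]
    gcongr

namespace IsSemiLevyProcess

/-- Ottaviani's inequality along `periodGrid`, whose leading time 0 makes the partial sums equal `X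
(τ j) - X 0`. By periodicity `b` serves every period, and the bound does not depend on the mesh. -/
theorem measure_exists_grid_norm_lt_le (h : IsSemiLevyProcess X P p) {b : ℝ}
    (hb : ∀ r ≤ p, 2⁻¹ ≤ P {ω | ‖X p ω - X r ω‖ ≤ b}) (a : ℝ) (n : ℕ) {M : ℕ} (hM : 0 < M) :
    P {ω | ∃ j : ℕ, j < M ∧ ‖X ((n + (j : ℝ≥0) / M) * p) ω - X 0 ω‖ < a} ≤
      2 * P {ω | ‖X ((n + 1 : ℕ) * p) ω - X 0 ω‖ < a + b} := by
  have hM' : (M : ℝ≥0) ≠ 0 := by exact_mod_cast hM.ne'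
  set τ := periodGrid p n M with hτ
  have hsum : ∀ j ω, ∑ i ∈ Finset.range j, (X (τ (i + 1)) ω - X (τ i) ω) = X (τ j) ω - X 0 ω :=
    fun j ω => Finset.sum_range_sub (fun i => X (τ i) ω) j
  have hτs : ∀ j ≤ M, τ (j + 1) = (n + (j : ℝ≥0) / M) * p := fun j hj => by
    simp only [hτ, periodGrid, min_eq_left hj]
  have hτN : τ (M + 1) = (n + 1 : ℕ) * p := by
    rw [hτs M le_rfl, div_self hM']; push_cast; rfl
  -- Index 0 is excluded: the tightness bound only covers times within the period.
  have key := iIndepFun.measure_exists_norm_sum_lt_le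
    (fun i => (h.measurable (τ (i + 1))).sub (h.measurable (τ i)))
    (h.indep_increments.nat (periodGrid_monotone p n M)) (M + 1) (Finset.Icc 1 (M + 1))
    (fun j hj => (Finset.mem_Icc.1 hj).2) a b ?_
  · simp only [Pi.sub_apply, hsum, hτN] at key
    refine le_trans (measure_mono ?_) key
    rintro ω ⟨j, hj, hja⟩
    refine ⟨j + 1, Finset.mem_Icc.2 ⟨by omega, by omega⟩, ?_⟩
    rwa [hτs j hj.le]
  · intro j hj
    obtain ⟨k, rfl⟩ : ∃ k, j = k + 1 := ⟨j - 1, by have := (Finset.mem_Icc.1 hj).1; omega⟩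
    have hk : k ≤ M := by have := (Finset.mem_Icc.1 hj).2; omega
    simp only [Pi.sub_apply, hsum, sub_sub_sub_cancel_right, hτN, hτs k hk]
    have hr : (k : ℝ≥0) / M * p ≤ p := by
      refine mul_le_of_le_one_left zero_le (div_le_one_of_le₀ ?_ zero_le)
      exact_mod_cast hk
    have hid := (h.identDistrib_sub_add_nat_mul ((k : ℝ≥0) / M * p) p n).measure_mem_eq
      (s := {x | ‖x‖ ≤ b}) (measurableSet_le measurable_norm measurable_const)
    rw [show ((n + 1 : ℕ) : ℝ≥0) * p = p + n * p by push_cast; ring,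
      show (n + (k : ℝ≥0) / M) * p = (k : ℝ≥0) / M * p + n * p by ring]
    exact (hb _ hr).trans hid.symm.le

/-- Dyadic grids are nested, so the mesh-free bound survives the increasing union. -/
theorem measure_exists_dyadic_norm_lt_le (h : IsSemiLevyProcess X P p) {b : ℝ}
    (hb : ∀ r ≤ p, 2⁻¹ ≤ P {ω | ‖X p ω - X r ω‖ ≤ b}) (a : ℝ) (n : ℕ) :
    P {ω | ∃ N : ℕ, ∃ j : ℕ, j < 2 ^ N ∧ ‖X ((n + (j : ℝ≥0) / (2 ^ N : ℕ)) * p) ω - X 0 ω‖ < a} ≤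
      2 * P {ω | ‖X ((n + 1 : ℕ) * p) ω - X 0 ω‖ < a + b} := by
  have hmono : Monotone fun N : ℕ =>
      {ω | ∃ j : ℕ, j < 2 ^ N ∧ ‖X ((n + (j : ℝ≥0) / (2 ^ N : ℕ)) * p) ω - X 0 ω‖ < a} := by
    refine monotone_nat_of_le_succ fun N ω => ?_
    rintro ⟨j, hj, hja⟩
    refine ⟨2 * j, by rw [pow_succ]; omega, ?_⟩
    have : ((2 * j : ℕ) : ℝ≥0) / (2 ^ (N + 1) : ℕ) = (j : ℝ≥0) / (2 ^ N : ℕ) := by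
      push_cast
      rw [pow_succ', mul_div_mul_left _ _ two_ne_zero]
    rwa [this]
  rw [Set.ofPred_exists, hmono.measure_iUnion]
  exact iSup_le fun N => h.measure_exists_grid_norm_lt_le hb a n (by positivity)

end IsSemiLevyProcess

theorem exists_dyadic_mem_of_continuousWithinAt {E : Type*} [TopologicalSpace E] {f : ℝ≥0 → E}
    {p t : ℝ≥0} (hp : 0 < p) (hf : ContinuousWithinAt f (Set.Ici t) t) {U : Set E}
    (hU : U ∈ 𝓝 (f t)) {n : ℕ} (hn : n * p ≤ t) (ht : t < (n + 1 : ℕ) * p) :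
    ∃ N : ℕ, ∃ j : ℕ, j < 2 ^ N ∧ f ((n + (j : ℝ≥0) / (2 ^ N : ℕ)) * p) ∈ U := by
  obtain ⟨u, hu, hsub⟩ := (mem_nhdsGE_iff_exists_Ico_subset' ht).1 (hf hU)
  -- Capping at the end of the period is what forces `j < 2 ^ N`; the mesh is then taken finer than
  -- `v - t`.
  set v := min u ((n + 1 : ℕ) * p) with hv
  have htv : t < v := lt_min hu ht
  obtain ⟨N, hN⟩ := exists_pow_lt_of_lt_one (div_pos (tsub_pos_of_lt htv) hp)
    (show (2⁻¹ : ℝ≥0) < 1 by rw [← NNReal.coe_lt_coe]; norm_num)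
  rw [lt_div_iff₀ hp, lt_tsub_iff_left] at hN
  have hpow : (0 : ℝ≥0) < 2 ^ N := by positivity
  -- Position of `t` in the period, in mesh units; rounding up gives a grid time in `[t, v)`.
  set x := (t / p - n) * 2 ^ N with hx
  have hnt : (n : ℝ≥0) ≤ t / p := by rwa [le_div_iff₀ hp]
  have htx : t = (n + x / 2 ^ N) * p := by
    rw [hx, mul_div_cancel_right₀ _ hpow.ne', add_tsub_cancel_of_le hnt, div_mul_cancel₀ _ hp.ne']
  have h1 : t ≤ (n + (⌈x⌉₊ : ℝ≥0) / (2 ^ N : ℕ)) * p := by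
    conv_lhs => rw [htx]
    push_cast
    gcongr
    exact Nat.le_ceil x
  have h2 : (n + (⌈x⌉₊ : ℝ≥0) / (2 ^ N : ℕ)) * p < v := by
    refine lt_of_le_of_lt ?_ hN
    conv_rhs => rw [htx]
    have : (⌈x⌉₊ : ℝ≥0) ≤ x + 1 := (Nat.ceil_lt_add_one zero_le).le
    calc (n + (⌈x⌉₊ : ℝ≥0) / (2 ^ N : ℕ)) * p ≤ (n + (x + 1) / 2 ^ N) * p := by
          push_cast; gcongr
      _ = (n + x / 2 ^ N) * p + 2⁻¹ ^ N * p := by rw [inv_pow]; ring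
  refine ⟨N, ⌈x⌉₊, ?_, hsub ⟨h1, h2.trans_le (min_le_left _ _)⟩⟩
  have h3 := h2.trans_le (min_le_right _ _)
  have h4 := lt_of_mul_lt_mul_right h3 zero_le
  push_cast at h4
  have h5 := (div_lt_one hpow).1 (lt_of_add_lt_add_left h4)
  exact_mod_cast h5

/-- The walk embedded in a semi-Lévy process that returns to the neighbourhood of its starting
point has infinitely many expected visits to some ball. -/
theorem IsSemiLevyProcess.exists_tsum_eq_top [IsProbabilityMeasure P]
    (h : IsSemiLevyProcess X P p) (hrec : IsRecurrentFrom X P 0) :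
    ∃ c : ℝ, ∑' n : ℕ, P {ω | ‖X (n * p) ω - X 0 ω‖ < c} = ∞ := by
  have hp : 0 < p := h.period_pos
  obtain ⟨b, hb⟩ := exists_forall_half_le_measure_norm_sub_le h.measurable
    h.stochastically_continuous (isCompact_Icc (a := 0) (b := p)) p
  -- Radius 1 for the path's visit, plus `b` for its movement up to the end of the period.
  refine ⟨1 + b, ?_⟩
  by_contra hfin
  set H : ℕ → Set Ω := fun n =>
    {ω | ∃ N : ℕ, ∃ j : ℕ, j < 2 ^ N ∧ ‖X ((n + (j : ℝ≥0) / (2 ^ N : ℕ)) * p) ω - X 0 ω‖ < 1} with hH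
  have hHfin : ∑' n, P (H n) ≠ ∞ := by
    have hle : ∑' n, P (H n) ≤ 2 * ∑' n : ℕ, P {ω | ‖X (n * p) ω - X 0 ω‖ < 1 + b} := by
      calc ∑' n, P (H n)
          ≤ ∑' n : ℕ, 2 * P {ω | ‖X ((n + 1 : ℕ) * p) ω - X 0 ω‖ < 1 + b} :=
            ENNReal.tsum_le_tsum fun n =>
              h.measure_exists_dyadic_norm_lt_le (fun r hr => hb r ⟨zero_le, hr⟩) 1 n
        _ ≤ _ := by
            rw [ENNReal.tsum_mul_left]
            refine mul_le_mul' le_rfl ?_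
            exact ENNReal.tsum_comp_le_tsum_of_injective (add_left_injective 1)
              (fun n : ℕ => P {ω | ‖X (n * p) ω - X 0 ω‖ < 1 + b})
    exact ne_top_of_le_ne_top (ENNReal.mul_ne_top (by simp) hfin) hle
  obtain ⟨ω, h1, h2, h3⟩ := ((ae_eventually_notMem hHfin).and (hrec.and h.cadlag)).exists
  obtain ⟨n₀, hn₀⟩ := eventually_atTop.1 h1
  have hfreq : ∃ᶠ t in atTop, ‖X t ω - X 0 ω‖ₑ < 1 :=
    frequently_lt_of_liminf_lt (by isBoundedDefault) (by rw [h2]; exact one_pos)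
  obtain ⟨t, ht1, ht0⟩ := (hfreq.and_eventually (eventually_ge_atTop (n₀ * p))).exists
  refine hn₀ ⌊t / p⌋₊ (Nat.le_floor ((le_div_iff₀ hp).2 ht0)) ?_
  have hcont : ContinuousWithinAt (fun s => ‖X s ω - X 0 ω‖) (Set.Ici t) t :=
    ((h3.1 t).sub continuousWithinAt_const).norm
  refine exists_dyadic_mem_of_continuousWithinAt (U := Set.Iio 1) hp hcont ?_ ?_ ?_
  · refine Iio_mem_nhds ?_
    rw [← ofReal_norm, ← ENNReal.ofReal_one, ENNReal.ofReal_lt_ofReal_iff one_pos] at ht1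
    exact ht1
  · exact (le_div_iff₀ hp).1 (Nat.floor_le zero_le)
  · rw [← div_lt_iff₀ hp]
    exact_mod_cast Nat.lt_floor_add_one (t / p)

/-- Recurrence passes to a semi-Lévy process with the same law over one period. -/
theorem IsSemiLevyProcess.isRecurrentProcess_of_identDistrib {Ω' : Type*} [MeasurableSpace Ω']
    {P' : Measure Ω'} [IsProbabilityMeasure P] [IsProbabilityMeasure P']
    {Y : ℝ≥0 → Ω' → EuclideanSpace ℝ (Fin d)} {q : ℝ≥0}
    (hX : IsSemiLevyProcess X P p) (hY : IsSemiLevyProcess Y P' q)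
    (hXY : IdentDistrib (X p) (Y q) P P') (hrec : IsRecurrentProcess X P) :
    IsRecurrentProcess Y P' :=
  let ⟨_, hc⟩ := hX.exists_tsum_eq_top (hrec 0)
  hX.isRecurrentProcess_of_tsum_eq_top hY hXY hc

end Hitting

theorem theorem1p2 {d : ℕ} {Ω Ω' : Type*} [MeasurableSpace Ω] [MeasurableSpace Ω']
    (P : Measure Ω) [IsProbabilityMeasure P] (P' : Measure Ω') [IsProbabilityMeasure P']
    (X : ℝ≥0 → Ω → EuclideanSpace ℝ (Fin d)) (Y : ℝ≥0 → Ω' → EuclideanSpace ℝ (Fin d))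
    (p : ℝ≥0) (hX : IsSemiLevyProcess X P p) (hY : IsLevyProcess Y P')
    (hXY : IdentDistrib (Y 1) (X p) P' P) :
    IsRecurrentProcess X P ↔ IsRecurrentProcess Y P' :=
  ⟨hX.isRecurrentProcess_of_identDistrib hY.isSemiLevyProcess_one hXY.symm,
    hY.isSemiLevyProcess_one.isRecurrentProcess_of_identDistrib hX hXY⟩
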